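/- Let $p\ge 1$, and let $(\Xi_k,\rho_k)$, $k=1,\dots,n$, be complete separable metric spaces with their Borel $\sigma$-algebras. Let $\Xi=\Xi_1\times\cdots\times\Xi_n$ carry a metric $\rho$ inducing the product topology. Write $\mathcal P_p(\Xi)$ and $\mathcal P_p(\Xi_k)$ for the sets of Borel probability measures with finite $p$th moment with respect to $\rho$ and $\rho_k$, respectively. For probability measures $Q_k,P_k$ on $\Xi_k$ let $$W_p(Q_k,P_k)=\inf_{\pi}\Big(\int_{\Xi_k\times\Xi_k}\rho_k(\zeta,\xi)^p\,d\pi(\zeta,\xi)\Big)^{1/p},$$ the infimum being over all couplings $\pi$ of $Q_k$ and $P_k$, and for $\varepsilon_k\ge 0$ let $\mathcal B_p(Q_k,\varepsilon_k)=\{P_k\in\mathcal P_p(\Xi_k): W_p(Q_k,P_k)\le\varepsilon_k\}$. For a probability measure $Q$ on $\Xi$ and $\boldsymbol\varepsilon=(\varepsilon_1,\dots,\varepsilon_n)$ with $\varepsilon_k\ge 0$, the multi-transport hyperrectangle $\mathcal T_p(Q,\boldsymbol\varepsilon)$ is the set of second marginals of all probability measures $\pi$ on $\Xi\times\Xi$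 with first marginal $Q$ such that $$\int_{\Xi\times\Xi}\rho_k(\zeta_k,\xi_k)^p\,d\pi(\zeta,\xi)\le\varepsilon_k^p\quad\text{for all }k=1,\dots,n.$$ Let $\xi=(\xi_1,\dots,\xi_n)$ be a random variable in $\Xi$ with independent components and law $P_\xi\in\mathcal P_p(\Xi)$, and let $P_{\xi_k}$ be the law of $\xi_k$. Let $N\ge1$, let $\xi^1,\dots,\xi^N$ be i.i.d. random variables with law $P_\xi$, let $P^N_{\xi_k}=\frac1N\sum_{i=1}^N\delta_{\xi^i_k}$ be the empirical distributions of the components, and let $\boldsymbol P^N_\xi=P^N_{\xi_1}\otimes\cdots\otimes P^N_{\xi_n}$ be the product empirical distribution. Let $\beta_k\in[0,1]$ and assume that $$\mathbb P\big(P_{\xi_k}\in\mathcal B_p(P^N_{\xi_k},\varepsilon_k)\big)\ge 1-\beta_k\quad\text{for all }k=1,\dots,n.$$ Then $\{P_\xi\in\mathcal T_p(\boldsymbol P^N_\xi,\boldsymbol\varepsilon)\}$ is an event (i.e. measurable) and $$\mathbb P\big(P_\xi\in\mathcal T_p(\boldsymbol P^N_\xi,\boldsymbol\varepsilon)\big)\ge\prod_{k=1}^n(1-\beta_k).$$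 -/

import Mathlib

open MeasureTheory ProbabilityTheory
open scoped NNReal ENNReal Topology

/-- `d` is a metric on the topological space `X` that induces its topology. -/
structure IsCompatibleMetric {X : Type*} [TopologicalSpace X] (d : X → X → ℝ) : Prop where
  eq_zero_iff : ∀ x y, d x y = 0 ↔ x = y
  symm : ∀ x y, d x y = d y x
  triangle : ∀ x y z, d x z ≤ d x y + d y z
  nhds_basis : ∀ x, (𝓝 x).HasBasis (fun r : ℝ => 0 < r) (fun r => {y | d y x < r})

/-- The measure `μ` has a finite `p`th moment with respect to the metric `d`. -/
def HasFiniteMoment {X : Type*} [MeasurableSpace X] (d : X → X → ℝ) (p : ℝ)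
    (μ : Measure X) : Prop :=
  ∃ x₀ : X, ∫⁻ x, ENNReal.ofReal (d x x₀ ^ p) ∂μ < ∞

/-- `𝒫_p(X)`: Borel probability measures with finite `p`th moment for the metric of `X`. -/
def finiteMomentMeasures (X : Type*) [MetricSpace X] [MeasurableSpace X] (p : ℝ) :
    Set (Measure X) :=
  {P | IsProbabilityMeasure P ∧ HasFiniteMoment dist p P}

/-- `𝒞(Q, P)`: transport plans, i.e. probability measures on `X × X` with marginals `Q`, `P`. -/
def couplings {X : Type*} [MeasurableSpace X] (Q P : Measure X) : Set (Measure (X × X)) :=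
  {π | IsProbabilityMeasure π ∧ π.map Prod.fst = Q ∧ π.map Prod.snd = P}

/-- The `p`th Wasserstein distance, as an extended nonnegative real. -/
noncomputable def wassersteinDist {X : Type*} [MetricSpace X] [MeasurableSpace X] (p : ℝ)
    (Q P : Measure X) : ℝ≥0∞ :=
  ⨅ π ∈ couplings Q P, (∫⁻ z, edist z.1 z.2 ^ p ∂π) ^ (1 / p)

/-- The Wasserstein ball `ℬ_p(Q, ε)`. -/
def wassersteinBall {X : Type*} [MetricSpace X] [MeasurableSpace X] (p : ℝ)
    (Q : Measure X) (ε : ℝ≥0) : Set (Measure X) :=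
  {P | P ∈ finiteMomentMeasures X p ∧ wassersteinDist p Q P ≤ ε}

/-- `Π(Q, ϵ; c)`: probability measures on `X × X` with first marginal `Q` whose expected
`k`th transport cost is at most `ϵ k`, for every `k`. -/
def transportPlans {X ι : Type*} [MeasurableSpace X] (c : ι → X → X → ℝ≥0)
    (Q : Measure X) (ϵ : ι → ℝ≥0) : Set (Measure (X × X)) :=
  {π | IsProbabilityMeasure π ∧ π.map Prod.fst = Q ∧
    ∀ k, ∫⁻ z, (c k z.1 z.2 : ℝ≥0∞) ∂π ≤ ϵ k}

/-- The multi-transport hyperrectangle `𝒯(Q, ϵ)` with transport costs `c`: the set of second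
marginals of the plans in `Π(Q, ϵ; c)`. -/
def multiTransport {X ι : Type*} [MeasurableSpace X] (c : ι → X → X → ℝ≥0)
    (Q : Measure X) (ϵ : ι → ℝ≥0) : Set (Measure X) :=
  (fun π : Measure (X × X) => π.map Prod.snd) '' transportPlans c Q ϵ

/-- `𝒯_p(Q, ε)` on a product space: costs `ρ_k(ζ_k, ξ_k)^p` and budgets `ε_k^p`. -/
noncomputable def multiTransportHyperrectangle {n : ℕ} {Ξ : Fin n → Type*}
    [∀ k, MetricSpace (Ξ k)] [∀ k, MeasurableSpace (Ξ k)] (p : ℝ)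
    (Q : Measure (∀ k, Ξ k)) (ε : Fin n → ℝ≥0) : Set (Measure (∀ k, Ξ k)) :=
  multiTransport (fun k ζ ξ => nndist (ζ k) (ξ k) ^ p) Q (fun k => ε k ^ p)

/-- The empirical distribution `(1/N) ∑ δ_{x i}` of the points `x`. -/
noncomputable def empiricalMeasure {X : Type*} [MeasurableSpace X] {N : ℕ} (x : Fin N → X) :
    Measure X :=
  (N : ℝ≥0∞)⁻¹ • ∑ i, Measure.dirac (x i)

/-- The product empirical distribution: the product of the empirical distributions of the
components of the points `x`. -/
noncomputable def productEmpiricalMeasure {n : ℕ} {Ξ : Fin n → Type*}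
    [∀ k, MeasurableSpace (Ξ k)] {N : ℕ} (x : Fin N → ∀ k, Ξ k) : Measure (∀ k, Ξ k) :=
  Measure.pi fun k => empiricalMeasure fun i => x i k

/-! The constraints defining the hyperrectangle act on one coordinate at a time. Projecting a plan
to its `k`th coordinates and, conversely, taking the product of optimal componentwise couplings show
that for product measures membership splits into `n` Wasserstein inequalities
(`pi_mem_multiTransportHyperrectangle_iff`); the converse needs optimal couplings to exist
(`wassersteinDist_le_iff`). The `k`th inequality depends only on the `k`th column of the sample.
Columns are independent, as rows and the entries within each row are (`iIndepFun.columns`), so the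
probabilities multiply. Measurability holds because the distance from an empirical measure to a
fixed measure is 1-Lipschitz in the sample points. -/

namespace ProbabilityTheory

/-- Grouping an independent family indexed by pairs `(i, j)` by its first index yields an
independent family of random vectors. -/
lemma iIndepFun.sigma_curry {ι Ω : Type*} {κ : ι → Type*} {𝓧 : (i : ι) → κ i → Type*}
    [∀ i j, MeasurableSpace (𝓧 i j)] [MeasurableSpace Ω] {P : Measure Ω}
    [IsProbabilityMeasure P]
    {X : (i : ι) → (j : κ i) → Ω → 𝓧 i j} (mX : ∀ i j, Measurable (X i j))
    (h : iIndepFun (fun (p : (i : ι) × κ i) ω => X p.1 p.2 ω) P) :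
    iIndepFun (fun i ω j => X i j ω) P := by
  have : ∀ i j, IsProbabilityMeasure (P.map (X i j)) :=
    fun i j => Measure.isProbabilityMeasure_map (mX i j).aemeasurable
  have hcurry : (MeasurableEquiv.piCurry 𝓧) ∘ (fun ω p => X p.1 p.2 ω) = fun ω i j => X i j ω := by
    ext; simp [Sigma.curry]
  have hrow (i : ι) : iIndepFun (X i) P :=
    h.precomp (g := fun j : κ i => (⟨i, j⟩ : (i : ι) × κ i)) sigma_mk_injective
  -- Independence says that the joint law is a product; currying carries a product over pairs to an
  -- iterated product.
  rw [iIndepFun_iff_map_fun_eq_infinitePi_map (by fun_prop)] at h ⊢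
  rw [← hcurry, ← Measure.map_map (by fun_prop) (by fun_prop), h,
    Measure.infinitePi_map_piCurry (fun i j => P.map (X i j))]
  congrm Measure.infinitePi fun i => ?_
  rw [(iIndepFun_iff_map_fun_eq_infinitePi_map (by fun_prop)).1 (hrow i)]

/-- If the rows of a random matrix are independent and each row has independent entries, then
its columns are independent. -/
lemma iIndepFun.columns {ι κ Ω : Type*} {𝓧 : κ → Type*}
    [∀ j, MeasurableSpace (𝓧 j)] [MeasurableSpace Ω] {P : Measure Ω}
    {X : ι → Ω → (j : κ) → 𝓧 j} (mX : ∀ i, Measurable (X i))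
    (hrows : iIndepFun X P) (hentries : ∀ i, iIndepFun (fun j ω => X i ω j) P) :
    iIndepFun (fun j ω i => X i ω j) P := by
  have := hrows.isProbabilityMeasure
  have mX' (i : ι) (j : κ) : Measurable fun ω => X i ω j := (measurable_pi_apply j).comp (mX i)
  have hpairs : iIndepFun (fun (p : ι × κ) ω => X p.1 ω p.2) P :=
    iIndepFun_uncurry' (X := fun i j ω => X i ω j) mX' hrows hentries
  have hinj : Function.Injective fun q : (_ : κ) × ι => (q.2, q.1) := by
    rintro ⟨a, b⟩ ⟨c, d⟩ h
    simp_all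
  exact iIndepFun.sigma_curry (X := fun j i ω => X i ω j) (fun j i => mX' i j)
    (hpairs.precomp hinj)

end ProbabilityTheory

lemma prod_mem_couplings {X : Type*} [MeasurableSpace X] (Q P : Measure X) [IsProbabilityMeasure Q]
    [IsProbabilityMeasure P] :
    Q.prod P ∈ couplings Q P := by
  refine ⟨inferInstance, ?_, ?_⟩
  · simp [Measure.map_fst_prod]
  · simp [Measure.map_snd_prod]

/-! ### Existence of optimal couplings -/

section Wasserstein

variable {X : Type*} [MetricSpace X] [MeasurableSpace X] [BorelSpace X]
  [SecondCountableTopology X]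

/-- The integral of a continuous nonnegative function is lower semicontinuous for the weak
convergence of probability measures. -/
lemma lowerSemicontinuous_lintegral_of_continuous {Y : Type*} [TopologicalSpace Y]
    [MeasurableSpace Y] [OpensMeasurableSpace Y] {c : Y → ℝ≥0} (hc : Continuous c) :
    LowerSemicontinuous fun π : ProbabilityMeasure Y => ∫⁻ z, (c z : ℝ≥0∞) ∂(π : Measure Y) := by
  -- Bounded truncations `min c m` have weakly continuous integrals, which increase to that of `c`
  -- by monotone convergence.
  let g (m : ℕ) : BoundedContinuousFunction Y ℝ≥0 :=
    BoundedContinuousFunction.mkOfBound ⟨fun z => min (c z) m, hc.min continuous_const⟩ m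
      fun x y => by
        rw [NNReal.dist_eq]
        exact abs_sub_le_of_nonneg_of_le (by positivity) (by simp) (by positivity) (by simp)
  have hsup (π : ProbabilityMeasure Y) : ∫⁻ z, (c z : ℝ≥0∞) ∂(π : Measure Y) =
      ⨆ m, ∫⁻ z, (g m z : ℝ≥0∞) ∂(π : Measure Y) := by
    rw [← lintegral_iSup]
    · refine lintegral_congr fun z => le_antisymm ?_ (iSup_le fun m => ?_)
      · obtain ⟨m, hm⟩ := exists_nat_ge (c z)
        refine le_iSup_of_le m ?_
        simp [g, min_eq_left hm]
      · simp [g]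
    · intro m
      exact (g m).continuous.measurable.coe_nnreal_ennreal
    · intro a b hab z
      simp only [g, BoundedContinuousFunction.mkOfBound_coe, ContinuousMap.coe_mk]
      gcongr
  simp_rw [hsup]
  exact lowerSemicontinuous_iSup fun m =>
    (ProbabilityMeasure.continuous_lintegral_boundedContinuousFunction (g m)).lowerSemicontinuous

/-- Prokhorov's theorem: fixed marginals are tight on a Polish space, hence so are the couplings,
and taking marginals is weakly continuous. -/
lemma isCompact_setOf_mem_couplings [CompleteSpace X] (Q P : Measure X) [IsProbabilityMeasure Q]
    [IsProbabilityMeasure P] :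
    IsCompact {π : ProbabilityMeasure (X × X) | (π : Measure (X × X)) ∈ couplings Q P} := by
  set S := {π : ProbabilityMeasure (X × X) | (π : Measure (X × X)) ∈ couplings Q P}
  have hclosed : IsClosed S := by
    have : S = {π | π.map (f := Prod.fst) measurable_fst.aemeasurable = ⟨Q, inferInstance⟩} ∩
        {π | π.map (f := Prod.snd) measurable_snd.aemeasurable = ⟨P, inferInstance⟩} := by
      ext π
      exact ⟨fun h => ⟨Subtype.ext h.2.1, Subtype.ext h.2.2⟩,
        fun h => ⟨inferInstance, congrArg Subtype.val h.1, congrArg Subtype.val h.2⟩⟩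
    rw [this]
    exact (isClosed_eq (ProbabilityMeasure.continuous_map continuous_fst) continuous_const).inter
      (isClosed_eq (ProbabilityMeasure.continuous_map continuous_snd) continuous_const)
  have htight : IsTightMeasureSet {((π : ProbabilityMeasure (X × X)) : Measure (X × X)) | π ∈ S} := by
    refine IsTightMeasureSet.prodMk ((isTightMeasureSet_singleton (μ := Q)).subset ?_)
      ((isTightMeasureSet_singleton (μ := P)).subset ?_)
    · rintro _ ⟨_, ⟨π, hπ, rfl⟩, rfl⟩
      exact hπ.2.1
    · rintro _ ⟨_, ⟨π, hπ, rfl⟩, rfl⟩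
      exact hπ.2.2
  rw [← hclosed.closure_eq]
  exact isCompact_closure_of_isTightMeasureSet htight

/-- The infimum defining the Wasserstein distance is attained. -/
lemma wassersteinDist_le_iff [CompleteSpace X] {p : ℝ} (hp : 1 ≤ p) (Q P : Measure X)
    [IsProbabilityMeasure Q] [IsProbabilityMeasure P] (ε : ℝ≥0) :
    wassersteinDist p Q P ≤ ε ↔ ∃ π ∈ couplings Q P,
      ∫⁻ z, ((nndist z.1 z.2 ^ p : ℝ≥0) : ℝ≥0∞) ∂π ≤ ((ε ^ p : ℝ≥0) : ℝ≥0∞) := by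
  have hp0 : 0 < p := by linarith
  have hcost (π : Measure (X × X)) : ∫⁻ z, edist z.1 z.2 ^ p ∂π =
      ∫⁻ z, ((nndist z.1 z.2 ^ p : ℝ≥0) : ℝ≥0∞) ∂π := by
    refine lintegral_congr fun z => ?_
    rw [edist_nndist, ENNReal.coe_rpow_of_nonneg _ hp0.le]
  have hle (π : Measure (X × X)) : (∫⁻ z, edist z.1 z.2 ^ p ∂π) ^ (1 / p) ≤ ε ↔
      ∫⁻ z, ((nndist z.1 z.2 ^ p : ℝ≥0) : ℝ≥0∞) ∂π ≤ ((ε ^ p : ℝ≥0) : ℝ≥0∞) := by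
    rw [hcost, one_div, ENNReal.rpow_inv_le_iff hp0, ENNReal.coe_rpow_of_nonneg _ hp0.le]
  constructor
  · intro h
    have hc : Continuous fun z : X × X => nndist z.1 z.2 ^ p :=
      (NNReal.continuous_rpow_const hp0.le).comp (continuous_fst.nndist continuous_snd)
    obtain ⟨π, hπ, hmin⟩ := LowerSemicontinuousOn.exists_isMinOn
      ⟨⟨Q.prod P, inferInstance⟩, prod_mem_couplings Q P⟩ (isCompact_setOf_mem_couplings Q P)
      ((lowerSemicontinuous_lintegral_of_continuous hc).lowerSemicontinuousOn _)
    refine ⟨π, hπ, (hle π).1 (le_trans (le_iInf₂ fun π' hπ' => ?_) h)⟩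
    have := hπ'.1
    simp only [hcost]
    exact ENNReal.rpow_le_rpow (hmin (a := ⟨π', hπ'.1⟩) hπ') (by positivity)
  · rintro ⟨π, hπ, h⟩
    exact iInf₂_le_of_le π hπ ((hle π).2 h)

end Wasserstein

/-! ### Empirical measures as images of the uniform law on indices -/

section Empirical

variable {X : Type*} [MeasurableSpace X] {N : ℕ}

lemma isProbabilityMeasure_empiricalMeasure (hN : 1 ≤ N) (x : Fin N → X) :
    IsProbabilityMeasure (empiricalMeasure x) := by
  constructor
  simp only [empiricalMeasure, Measure.smul_apply, Measure.coe_finsetSum, Finset.sum_apply,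
    measure_univ, Finset.sum_const, Finset.card_univ, Fintype.card_fin, nsmul_eq_mul, mul_one,
    smul_eq_mul]
  exact ENNReal.inv_mul_cancel (by simp; omega) (by simp)

lemma map_empiricalMeasure_id (x : Fin N → X) :
    (empiricalMeasure (id : Fin N → Fin N)).map x = empiricalMeasure x := by
  have hx : Measurable x := measurable_of_finite x
  simp only [empiricalMeasure, Measure.map_smul, id]
  congr 1
  ext s hs
  simp [Measure.map_apply hx hs, Measure.dirac_apply' _ hs,
    Measure.dirac_apply' _ (hx hs), Set.indicator]
  rfl

/-- A coupling of an empirical distribution with `P` lifts to a coupling of the uniform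
distribution on the indices with `P`. -/
lemma exists_lift_of_mem_couplings [StandardBorelSpace X] (hN : 1 ≤ N) (x : Fin N → X)
    {P : Measure X} {π : Measure (X × X)} (hπ : π ∈ couplings (empiricalMeasure x) P) :
    ∃ η : Measure (Fin N × X), IsProbabilityMeasure η ∧
      η.map Prod.fst = empiricalMeasure (id : Fin N → Fin N) ∧
      η.map (fun w => (x w.1, w.2)) = π := by
  obtain ⟨hprob, hfst, -⟩ := hπ
  have : Nonempty X := ⟨x ⟨0, hN⟩⟩
  have hx : Measurable x := measurable_of_finite x
  have hu := isProbabilityMeasure_empiricalMeasure hN (id : Fin N → Fin N)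
  set u := empiricalMeasure (id : Fin N → Fin N)
  -- Draw a uniform index `i`, then draw from the disintegration of `π` at `x i`. This also works
  -- when some sample points coincide.
  refine ⟨u ⊗ₘ (π.condKernel.comap x hx), inferInstance, Measure.fst_compProd u _, ?_⟩
  conv_rhs => rw [← π.disintegrate π.condKernel]
  have hfst' : π.fst = u.map x := by
    rw [map_empiricalMeasure_id, ← hfst]; rfl
  have hmeas : Measurable fun w : Fin N × X => (x w.1, w.2) :=
    (hx.comp measurable_fst).prodMk measurable_snd
  ext s hs
  rw [Measure.map_apply hmeas hs, Measure.compProd_apply (hmeas hs), hfst',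
    Measure.compProd_apply hs, lintegral_map (Kernel.measurable_kernel_prodMk_left hs) hx]
  rfl

end Empirical

/-! ### Dependence of the distance on the sample points -/

section Measurability

variable {X : Type*} [MetricSpace X] [MeasurableSpace X] [BorelSpace X]
  [SecondCountableTopology X] [CompleteSpace X] {N : ℕ}

/-- Lift a coupling from the points `y` to the indices and push it forward along `x`: each point
moves by at most the sup distance, and Minkowski's inequality bounds the change in cost. -/
lemma wassersteinDist_empiricalMeasure_le_add_edist {p : ℝ} (hp : 1 ≤ p) (hN : 1 ≤ N)
    (P : Measure X) (x y : Fin N → X) :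
    wassersteinDist p (empiricalMeasure x) P ≤
      wassersteinDist p (empiricalMeasure y) P + edist x y := by
  have hp0 : 0 < p := by linarith
  rw [wassersteinDist, wassersteinDist, ENNReal.iInf₂_add]
  refine le_iInf₂ fun π hπ => ?_
  obtain ⟨η, hη, hfst, rfl⟩ := exists_lift_of_mem_couplings hN y hπ
  have hx : Measurable x := measurable_of_finite x
  have hy : Measurable y := measurable_of_finite y
  have hmx : Measurable fun w : Fin N × X => (x w.1, w.2) :=
    (hx.comp measurable_fst).prodMk measurable_snd
  have hmy : Measurable fun w : Fin N × X => (y w.1, w.2) :=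
    (hy.comp measurable_fst).prodMk measurable_snd
  have hcost : Measurable fun z : X × X => edist z.1 z.2 ^ p :=
    (measurable_fst.edist measurable_snd).pow_const p
  have hmem : η.map (fun w => (x w.1, w.2)) ∈ couplings (empiricalMeasure x) P := by
    refine ⟨Measure.isProbabilityMeasure_map hmx.aemeasurable, ?_, ?_⟩
    · rw [Measure.map_map measurable_fst hmx, ← map_empiricalMeasure_id, ← hfst,
        Measure.map_map hx measurable_fst]
      rfl
    · rw [← hπ.2.2, Measure.map_map measurable_snd hmx, Measure.map_map measurable_snd hmy]
      rfl
  refine iInf₂_le_of_le _ hmem ?_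
  rw [lintegral_map hcost hmx, lintegral_map hcost hmy]
  let f (w : Fin N × X) : ℝ≥0∞ := edist (y w.1) w.2
  let g (w : Fin N × X) : ℝ≥0∞ := edist (x w.1) (y w.1)
  have hf : Measurable f := (hy.comp measurable_fst).edist measurable_snd
  have hg : Measurable g := (hx.comp measurable_fst).edist (hy.comp measurable_fst)
  calc (∫⁻ w, edist (x w.1) w.2 ^ p ∂η) ^ (1 / p)
      ≤ (∫⁻ w, (f + g) w ^ p ∂η) ^ (1 / p) := by
        gcongr with w
        exact (edist_triangle _ (y w.1) _).trans (add_comm _ _).le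
    _ ≤ (∫⁻ w, f w ^ p ∂η) ^ (1 / p) + (∫⁻ w, g w ^ p ∂η) ^ (1 / p) :=
        ENNReal.lintegral_Lp_add_le hf.aemeasurable hg.aemeasurable hp
    _ ≤ (∫⁻ w, f w ^ p ∂η) ^ (1 / p) + (∫⁻ _, edist x y ^ p ∂η) ^ (1 / p) := by
        gcongr with w
        exact edist_le_pi_edist x y w.1
    _ = (∫⁻ w, f w ^ p ∂η) ^ (1 / p) + edist x y := by
        rw [lintegral_const, measure_univ, mul_one, one_div, ENNReal.rpow_rpow_inv hp0.ne']

lemma measurable_wassersteinDist_empiricalMeasure {p : ℝ} (hp : 1 ≤ p) (hN : 1 ≤ N)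
    (P : Measure X) :
    Measurable fun x : Fin N → X => wassersteinDist p (empiricalMeasure x) P :=
  (continuous_of_le_add_edist 1 ENNReal.one_ne_top fun x y => by
    simpa using wassersteinDist_empiricalMeasure_le_add_edist hp hN P x y).measurable

end Measurability

/-- A product measure belongs to the multi-transport hyperrectangle around a product measure if
and only if each factor is within the corresponding Wasserstein radius. -/
lemma pi_mem_multiTransportHyperrectangle_iff {n : ℕ} {Ξ : Fin n → Type*}
    [∀ k, MetricSpace (Ξ k)] [∀ k, CompleteSpace (Ξ k)] [∀ k, SecondCountableTopology (Ξ k)]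
    [∀ k, MeasurableSpace (Ξ k)] [∀ k, BorelSpace (Ξ k)] {p : ℝ} (hp : 1 ≤ p)
    (Q P : ∀ k, Measure (Ξ k)) [∀ k, IsProbabilityMeasure (Q k)]
    [∀ k, IsProbabilityMeasure (P k)] (ε : Fin n → ℝ≥0) :
    Measure.pi P ∈ multiTransportHyperrectangle p (Measure.pi Q) ε ↔
      ∀ k, wassersteinDist p (Q k) (P k) ≤ ε k := by
  have hcost (k : Fin n) :
      Measurable fun z : Ξ k × Ξ k => ((nndist z.1 z.2 ^ p : ℝ≥0) : ℝ≥0∞) :=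
    ((measurable_fst.nndist measurable_snd).pow_const p).coe_nnreal_ennreal
  simp_rw [wassersteinDist_le_iff hp]
  constructor
  · rintro ⟨π, ⟨hprob, hfst, hle⟩, hsnd⟩ k
    have hk : Measurable fun z : (∀ k, Ξ k) × (∀ k, Ξ k) => (z.1 k, z.2 k) := by fun_prop
    refine ⟨π.map fun z => (z.1 k, z.2 k),
      ⟨Measure.isProbabilityMeasure_map hk.aemeasurable, ?_, ?_⟩, ?_⟩
    · rw [← (measurePreserving_eval Q k).map_eq, ← hfst, Measure.map_map (by fun_prop) hk,
        Measure.map_map (by fun_prop) (by fun_prop)]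
      rfl
    · rw [← (measurePreserving_eval P k).map_eq, ← hsnd, Measure.map_map (by fun_prop) hk,
        Measure.map_map (by fun_prop) (by fun_prop)]
      rfl
    · rw [lintegral_map (hcost k) hk]
      exact hle k
  · intro h
    choose π hπ hle using h
    have hprob (k : Fin n) : IsProbabilityMeasure (π k) := (hπ k).1
    have hm : Measurable fun z : ∀ k, Ξ k × Ξ k => (fun k => (z k).1, fun k => (z k).2) := by
      fun_prop
    have h1 (k : Fin n) : IsProbabilityMeasure ((π k).map Prod.fst) :=
      Measure.isProbabilityMeasure_map measurable_fst.aemeasurable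
    have h2 (k : Fin n) : IsProbabilityMeasure ((π k).map Prod.snd) :=
      Measure.isProbabilityMeasure_map measurable_snd.aemeasurable
    -- The product of the optimal couplings, with a family of pairs regrouped as a pair of families.
    refine ⟨(Measure.pi π).map fun z => (fun k => (z k).1, fun k => (z k).2),
      ⟨Measure.isProbabilityMeasure_map hm.aemeasurable, ?_, fun k => ?_⟩, ?_⟩
    · rw [Measure.map_map measurable_fst hm]
      refine (Measure.pi_map_pi (f := fun _ => Prod.fst)
        fun k => measurable_fst.aemeasurable).trans ?_
      exact congrArg Measure.pi (funext fun k => (hπ k).2.1)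
    · refine le_trans (le_of_eq ?_) (hle k)
      have hk : Measurable fun z : (∀ k, Ξ k) × (∀ k, Ξ k) => (z.1 k, z.2 k) := by fun_prop
      rw [lintegral_map (f := fun z => ((nndist (z.1 k) (z.2 k) ^ p : ℝ≥0) : ℝ≥0∞))
        ((hcost k).comp hk) hm, ← (measurePreserving_eval π k).map_eq,
        lintegral_map (hcost k) (measurable_pi_apply k)]
    · change Measure.map _ _ = _
      rw [Measure.map_map measurable_snd hm]
      refine (Measure.pi_map_pi (f := fun _ => Prod.snd)
        fun k => measurable_snd.aemeasurable).trans ?_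
      exact congrArg Measure.pi (funext fun k => (hπ k).2.2)

theorem mainTheorem6 {n : ℕ} {Ξ : Fin n → Type*}
    [∀ k, MetricSpace (Ξ k)] [∀ k, CompleteSpace (Ξ k)] [∀ k, SecondCountableTopology (Ξ k)]
    [∀ k, MeasurableSpace (Ξ k)] [∀ k, BorelSpace (Ξ k)]
    -- the metric on the product space
    (ρ : (∀ k, Ξ k) → (∀ k, Ξ k) → ℝ) (hρ : IsCompatibleMetric ρ)
    (p : ℝ) (hp : 1 ≤ p)
    -- the random variable, with independent components and finite moment
    {Ω₀ : Type*} [MeasurableSpace Ω₀] (P₀ : Measure Ω₀) [IsProbabilityMeasure P₀]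
    (ξ : Ω₀ → ∀ k, Ξ k) (hξ : Measurable ξ)
    (hindep : iIndepFun (fun k ω => ξ ω k) P₀)
    (hmoment : HasFiniteMoment ρ p (P₀.map ξ))
    -- the samples
    {Ω : Type*} [MeasurableSpace Ω] (P : Measure Ω) [IsProbabilityMeasure P]
    {N : ℕ} (hN : 1 ≤ N) (sample : Fin N → Ω → ∀ k, Ξ k)
    (hsample : ∀ i, Measurable (sample i))
    (hsample_indep : iIndepFun sample P)
    (hsample_law : ∀ i, P.map (sample i) = P₀.map ξ)
    -- the radii and confidence levels of the componentwise balls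
    (ε : Fin n → ℝ≥0) (β : Fin n → ℝ) (hβ : ∀ k, β k ∈ Set.Icc (0 : ℝ) 1)
    (hball : ∀ k, 1 - β k ≤ P.real {ω | P₀.map (fun ω₀ => ξ ω₀ k) ∈
      wassersteinBall p (empiricalMeasure fun i => sample i ω k) (ε k)}) :
    MeasurableSet {ω | P₀.map ξ ∈
      multiTransportHyperrectangle p (productEmpiricalMeasure fun i => sample i ω) ε} ∧
    ∏ k, (1 - β k) ≤ P.real {ω | P₀.map ξ ∈
      multiTransportHyperrectangle p (productEmpiricalMeasure fun i => sample i ω) ε} := by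
  have hξk (k : Fin n) : Measurable fun ω₀ => ξ ω₀ k := (measurable_pi_apply k).comp hξ
  have hPk (k : Fin n) : IsProbabilityMeasure (P₀.map fun ω₀ => ξ ω₀ k) :=
    Measure.isProbabilityMeasure_map (hξk k).aemeasurable
  have hlaw : P₀.map ξ = Measure.pi fun k => P₀.map fun ω₀ => ξ ω₀ k :=
    hindep.map_fun_eq_pi_map fun k => (hξk k).aemeasurable
  have hcolumn (k : Fin n) : Measurable fun ω i => sample i ω k :=
    measurable_pi_lambda _ fun i => (measurable_pi_apply k).comp (hsample i)
  have hentries (i : Fin N) : iIndepFun (fun k ω => sample i ω k) P := by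
    rw [iIndepFun_iff_map_fun_eq_pi_map (f := fun k ω => sample i ω k)
      fun k => ((measurable_pi_apply k).comp (hsample i)).aemeasurable]
    refine (hsample_law i).trans (hlaw.trans (congrArg Measure.pi (funext fun k => ?_)))
    change P₀.map ((fun x => x k) ∘ ξ) = P.map ((fun x => x k) ∘ sample i)
    rw [← Measure.map_map (measurable_pi_apply k) hξ,
      ← Measure.map_map (measurable_pi_apply k) (hsample i), hsample_law i]
  have hcolumns : iIndepFun (fun k ω i => sample i ω k) P :=
    iIndepFun.columns hsample hsample_indep hentries
  let A (k : Fin n) : Set (Fin N → Ξ k) :=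
    {x | wassersteinDist p (empiricalMeasure x) (P₀.map fun ω₀ => ξ ω₀ k) ≤ ε k}
  have hA (k : Fin n) : MeasurableSet (A k) :=
    measurable_wassersteinDist_empiricalMeasure hp hN _ measurableSet_Iic
  have hevent : {ω | P₀.map ξ ∈
      multiTransportHyperrectangle p (productEmpiricalMeasure fun i => sample i ω) ε} =
      ⋂ k, (fun ω i => sample i ω k) ⁻¹' A k := by
    ext ω
    have (k : Fin n) := isProbabilityMeasure_empiricalMeasure hN fun i => sample i ω k
    simp only [Set.mem_ofPred_eq, Set.mem_iInter, Set.mem_preimage, hlaw, productEmpiricalMeasure, A]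
    exact pi_mem_multiTransportHyperrectangle_iff hp _ _ ε
  rw [hevent]
  refine ⟨MeasurableSet.iInter fun k => hcolumn k (hA k), ?_⟩
  rw [Measure.real, hcolumns.meas_iInter fun k => ⟨A k, hA k, rfl⟩, ENNReal.toReal_prod]
  refine Finset.prod_le_prod (fun k _ => sub_nonneg.2 (hβ k).2) fun k _ => (hball k).trans ?_
  -- The ball also carries the moment condition, so its event lies in the event of `A k`.
  exact measureReal_mono fun ω hω => hω.2
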